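/- Consider Plotkin's call-by-value $\lambda$-calculus: (possibly open) terms $t,u ::= v \mid t\,u$ up to $\alpha$-equivalence, with values $v ::= x \mid \lambda x.t$. Left contexts are $L ::= \langle\cdot\rangle \mid v\,L \mid L\,t$, and left reduction $\to_l$ is the closure under left contexts of $(\lambda x.t)\,v \mapsto t\{x\leftarrow v\}$ with $v$ a value. Write $t \Downarrow_l n$ if $t \to_l^* n$ and $n$ is $\to_l$-normal. A relation $\mathcal R$ on terms is an \emph{enf simulation} (eager normal form simulation) if $t \mathrel{\mathcal R} t'$ implies that at least one of the following holds: (1) $t$ has no $\to_l$-normal form; (2) $t \Downarrow_l x$ and $t' \Downarrow_l x$ for some variable $x$; (3) $t \Downarrow_l \lambda x.t_1$ and $t' \Downarrow_l \lambda x.t_1'$ with $t_1 \mathrel{\mathcal R} t_1'$; (4) $t \Downarrow_l L\langle x v\rangle$ and $t' \Downarrow_l L'\langle x v'\rangle$ with $v,v'$ values, $v \mathrel{\mathcal R} v'$ and $L\langle z\rangle \mathrel{\mathcal R} L'\langle z\rangle$, where $z$ is not free in $L$ or $L'$. Lassen's enf similarity $\precsim_{enf}$ is the union of all enf simulations. Linear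 types $L ::= M \multimap N$ and multi types $M,N ::= [L_1,\dots,L_n]$ ($n\ge 0$, finite multisets) are mutually inductively defined. Typing contexts $\Gamma$ assign multi types to finitely many variables (the other variables having the empty multi type $[\,]$), and $\uplus$ is the (pointwise) sum of multisets. Terms with explicit substitutions $t[x\leftarrow u]$ (of which the $\lambda$-terms above are a special case) are typed by the rules: (ax) $x:[L] \vdash x : L$; ($\lambda$) from $\Gamma, x:M \vdash t:N$ infer $\Gamma \vdash \lambda x.t : M\multimap N$; (many) from $\Gamma_i \vdash v : L_i$ for $i$ in a finite, possibly empty, set $I$, with $v$ a value, infer $\biguplus_{i\in I}\Gamma_i \vdash v : \biguplus_{i \in I}[L_i]$; (@) from $\Gamma \vdash t : [M\multimap N]$ and $\Delta\vdash u:M$ infer $\Gamma\uplus\Delta \vdash t\,u : N$; (es) from $\Gamma, x:M \vdash t:N$ and $\Delta \vdash u:M$ infer $\Gamma\uplus\Delta\vdash t[x\leftarrow u]:N$. The type preorder $t \precsim_{type} t'$ holds if, for all $\Gamma$ and all multi types $M$, $\Gamma\vdash t:M$ implies $\Gamma\vdash t':M$. \textbf{Proposition (Enf is included in Type).} 1.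 Let $\mathcal R$ be an enf simulation. If $t \mathrel{\mathcal R} t'$ and there is a derivation of $\Gamma \vdash t : M$, with $M$ a multi type, then there is a derivation of $\Gamma\vdash t' : M$. 2. If $t \precsim_{enf} t'$ then $t \precsim_{type} t'$. -/

import Mathlib

namespace CbV

/-! ## Plotkin's call-by-value lambda-calculus

Terms up to alpha-equivalence, with de Bruijn indices: variables are natural numbers, and under
a binder the index `0` is the bound variable while `n + 1` is the outer variable `n`. Terms may be
open, every natural number being available as a free variable. -/

/-- Terms `t, u ::= x | lam x. t | t u`. -/
inductive Tm : Type
  | var : ℕ → Tm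
  | lam : Tm → Tm
  | app : Tm → Tm → Tm

namespace Tm

/-- Values are variables and abstractions. -/
inductive IsValue : Tm → Prop
  | var (x : ℕ) : IsValue (var x)
  | lam (t : Tm) : IsValue (lam t)

/-- Capture-avoiding renaming of the free variables. -/
def rename : (ℕ → ℕ) → Tm → Tm
  | f, var x => var (f x)
  | f, lam t => lam (rename (fun n => Nat.casesOn n 0 (fun k => f k + 1)) t)
  | f, app t u => app (rename f t) (rename f u)

/-- Capture-avoiding parallel substitution of the free variables. -/
def subst : (ℕ → Tm) → Tm → Tm
  | s, var x => s x
  | s, lam t => lam (subst (fun n => Nat.casesOn n (var 0) (fun k => rename Nat.succ (s k))) t)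
  | s, app t u => app (subst s t) (subst s u)

/-- `t.inst u` is `t{x ← u}`, where `x` is the variable with index `0` in `t`, which disappears. -/
def inst (t u : Tm) : Tm :=
  subst (fun n => Nat.casesOn n u var) t

/-- `t.HasFree z`: the variable `z` occurs free in `t`. -/
def HasFree : Tm → ℕ → Prop
  | var x, z => x = z
  | lam t, z => HasFree t (z + 1)
  | app t u, z => HasFree t z ∨ HasFree u z

end Tm

/-- Left contexts `L ::= ⟨·⟩ | v L | L t`, with `v` a value. -/
inductive LCtx : Type
  | hole : LCtx
  | valApp (v : Tm) (hv : v.IsValue) (L : LCtx) : LCtx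
  | app (L : LCtx) (t : Tm) : LCtx

namespace LCtx

/-- Plugging `L⟨t⟩`. The hole of a left context is never under a binder. -/
def plug : LCtx → Tm → Tm
  | hole, t => t
  | valApp v _ L, t => Tm.app v (L.plug t)
  | app L u, t => Tm.app (L.plug t) u

/-- `L.HasFree z`: the variable `z` occurs free in the context `L`. -/
def HasFree : LCtx → ℕ → Prop
  | hole, _ => False
  | valApp v _ L, z => v.HasFree z ∨ L.HasFree z
  | app L u, z => L.HasFree z ∨ u.HasFree z

end LCtx

/-- Root reduction `(lam x. t) v ↦ t{x ← v}`, with `v` a value. -/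
inductive RootBeta : Tm → Tm → Prop
  | beta (t v : Tm) (hv : v.IsValue) : RootBeta (Tm.app (Tm.lam t) v) (t.inst v)

/-- Left (to right) reduction: the closure of root reduction by left contexts. -/
inductive LeftRed : Tm → Tm → Prop
  | ctx (L : LCtx) {t u : Tm} (h : RootBeta t u) : LeftRed (L.plug t) (L.plug u)

/-- Left normal terms. -/
def LeftNormal (t : Tm) : Prop :=
  ∀ u, ¬ LeftRed t u

/-- Big-step left evaluation: `t` left-reduces, in some number of steps, to the left normal
term `n`. -/
def LeftEval (t n : Tm) : Prop :=
  Relation.ReflTransGen LeftRed t n ∧ LeftNormal n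

/-- Left divergence: `t` has no left normal form. -/
def LeftDiv (t : Tm) : Prop :=
  ¬ ∃ n, LeftEval t n

/-- The four clauses of eager normal form simulations. In the third one, the common bound
variable of the two abstractions is the index `0` of the two bodies. -/
inductive EnfClause (R : Tm → Tm → Prop) (t t' : Tm) : Prop
  | enf1 (h : LeftDiv t) : EnfClause R t t'
  | enf2 (x : ℕ) (h : LeftEval t (Tm.var x)) (h' : LeftEval t' (Tm.var x)) : EnfClause R t t'
  | enf3 (b b' : Tm) (h : LeftEval t (Tm.lam b)) (h' : LeftEval t' (Tm.lam b'))
      (hb : R b b') : EnfClause R t t'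
  | enf4 (L L' : LCtx) (x : ℕ) (v v' : Tm) (hv : v.IsValue) (hv' : v'.IsValue)
      (h : LeftEval t (L.plug (Tm.app (Tm.var x) v)))
      (h' : LeftEval t' (L'.plug (Tm.app (Tm.var x) v')))
      (hR : R v v')
      (z : ℕ) (hz : ¬ L.HasFree z) (hz' : ¬ L'.HasFree z)
      (hL : R (L.plug (Tm.var z)) (L'.plug (Tm.var z))) : EnfClause R t t'

/-- `R` is an eager normal form (enf) simulation. -/
def IsEnfSimulation (R : Tm → Tm → Prop) : Prop :=
  ∀ t t', R t t' → EnfClause R t t'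

/-- Enf similarity: the union of all enf simulations. -/
def EnfSimilar (t t' : Tm) : Prop :=
  ∃ R : Tm → Tm → Prop, IsEnfSimulation R ∧ R t t'

/-! ## Terms with explicit substitutions -/

/-- Terms of the value substitution calculus, `t, u ::= x | lam x. t | t u | t[x ← u]`, again with
de Bruijn indices: `es t u` is `t[x ← u]`, and binds the index `0` in `t`. -/
inductive VTm : Type
  | var : ℕ → VTm
  | lam : VTm → VTm
  | app : VTm → VTm → VTm
  | es : VTm → VTm → VTm

/-- Values of the value substitution calculus. -/
inductive VTm.IsValue : VTm → Prop
  | var (x : ℕ) : VTm.IsValue (VTm.var x)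
  | lam (t : VTm) : VTm.IsValue (VTm.lam t)

/-- Ordinary lambda-terms are the terms without explicit substitutions. -/
def Tm.toVTm : Tm → VTm
  | Tm.var x => VTm.var x
  | Tm.lam t => VTm.lam t.toVTm
  | Tm.app t u => VTm.app t.toVTm u.toVTm

/-! ## Linear and multi types

`L ::= M ⊸ N` and `M, N ::= [L₁, …, Lₙ]` with `n ≥ 0`, where `[L₁, …, Lₙ]` is a finite multiset.
Linear types are built as finite trees, with lists in place of multisets, modulo the hereditary
reordering of the lists. -/

/-- Representatives of linear types, with lists in place of multisets. -/
inductive PreLin : Type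
  | arrow : List PreLin → List PreLin → PreLin

/-- Equality of representatives up to hereditary reordering of the lists. -/
inductive PreLin.Equiv : PreLin → PreLin → Prop
  | arrow {l₁ l₂ r₁ r₂ : List PreLin}
      (hl : Multiset.Rel PreLin.Equiv (l₁ : Multiset PreLin) (l₂ : Multiset PreLin))
      (hr : Multiset.Rel PreLin.Equiv (r₁ : Multiset PreLin) (r₂ : Multiset PreLin)) :
      PreLin.Equiv (PreLin.arrow l₁ r₁) (PreLin.arrow l₂ r₂)

theorem PreLin.equiv_arrow {l₁ l₂ r₁ r₂ : List PreLin}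
    (h : PreLin.Equiv (.arrow l₁ r₁) (.arrow l₂ r₂)) :
    Multiset.Rel PreLin.Equiv (l₁ : Multiset PreLin) (l₂ : Multiset PreLin) ∧
      Multiset.Rel PreLin.Equiv (r₁ : Multiset PreLin) (r₂ : Multiset PreLin) := by
  cases h with
  | arrow hl hr => exact ⟨hl, hr⟩

theorem PreLin.induction {P : PreLin → Prop}
    (h : ∀ l r : List PreLin, (∀ a ∈ l, P a) → (∀ a ∈ r, P a) → P (.arrow l r))
    (a : PreLin) : P a := by
  refine PreLin.rec (motive_1 := P) (motive_2 := fun l => ∀ b ∈ l, P b) h ?_ ?_ a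
  · intro b hb
    cases hb
  · intro a l ha hl b hb
    rcases List.mem_cons.1 hb with rfl | hb
    · exact ha
    · exact hl b hb

theorem PreLin.equiv_refl (a : PreLin) : PreLin.Equiv a a := by
  induction a using PreLin.induction with
  | h l r hl hr => exact .arrow (Multiset.rel_refl_of_refl_on hl) (Multiset.rel_refl_of_refl_on hr)

theorem PreLin.equiv_symm (a : PreLin) : ∀ b, PreLin.Equiv a b → PreLin.Equiv b a := by
  induction a using PreLin.induction with
  | h l r hl hr =>
    rintro ⟨l', r'⟩ h
    obtain ⟨h1, h2⟩ := PreLin.equiv_arrow h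
    exact .arrow (Multiset.rel_flip.1 (h1.mono fun x hx y _ hxy => hl x hx y hxy))
      (Multiset.rel_flip.1 (h2.mono fun x hx y _ hxy => hr x hx y hxy))

theorem rel_trans_on {α : Type*} {p : α → α → Prop} {s t u : Multiset α}
    (h : Multiset.Rel (fun x y => ∀ z, p y z → p x z) s t) (h' : Multiset.Rel p t u) :
    Multiset.Rel p s u := by
  induction h generalizing u with
  | zero => exact h'
  | cons hab _ ih =>
    obtain ⟨c, u', hc, hu', rfl⟩ := Multiset.rel_cons_left.1 h'
    exact Multiset.Rel.cons (hab c hc) (ih hu')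

theorem PreLin.equiv_trans (a : PreLin) :
    ∀ b c, PreLin.Equiv a b → PreLin.Equiv b c → PreLin.Equiv a c := by
  induction a using PreLin.induction with
  | h l r hl hr =>
    rintro ⟨l', r'⟩ ⟨l'', r''⟩ h h'
    obtain ⟨h1, h2⟩ := PreLin.equiv_arrow h
    obtain ⟨h1', h2'⟩ := PreLin.equiv_arrow h'
    exact .arrow (rel_trans_on (h1.mono fun x hx y _ hxy z hyz => hl x hx y z hxy hyz) h1')
      (rel_trans_on (h2.mono fun x hx y _ hxy z hyz => hr x hx y z hxy hyz) h2')

def PreLin.setoid : Setoid PreLin where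
  r := PreLin.Equiv
  iseqv := ⟨PreLin.equiv_refl, fun {a b} => PreLin.equiv_symm a b,
    fun {a b c} => PreLin.equiv_trans a b c⟩

/-- Linear types. -/
def LinTy : Type := Quotient PreLin.setoid

/-- Multi types: finite multisets of linear types. -/
abbrev MultiTy : Type := Multiset LinTy

/-- The class of a representative. -/
def LinTy.mk (a : PreLin) : LinTy := Quotient.mk PreLin.setoid a

/-- A representative of a linear type. -/
noncomputable def LinTy.out (L : LinTy) : PreLin := Quotient.out L

theorem LinTy.mk_out (L : LinTy) : LinTy.mk L.out = L := Quotient.out_eq L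

/-- The linear type `M ⊸ N`. -/
noncomputable def LinTy.arrow (M N : MultiTy) : LinTy :=
  LinTy.mk (PreLin.arrow (M.toList.map LinTy.out) (N.toList.map LinTy.out))

/-- Multisets of representatives with the same classes are related. -/
theorem rel_of_map_mk_eq {s t : Multiset PreLin} (h : s.map LinTy.mk = t.map LinTy.mk) :
    Multiset.Rel PreLin.Equiv s t := by
  have h1 : Multiset.Rel (· = ·) (s.map LinTy.mk) (t.map LinTy.mk) := Multiset.rel_eq.2 h
  exact (Multiset.rel_map.1 h1).mono fun a _ b _ hab => Quotient.exact hab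

theorem map_mk_map_out (M : MultiTy) :
    Multiset.map LinTy.mk (↑(M.toList.map LinTy.out) : Multiset PreLin) = M := by
  have hid : LinTy.mk ∘ LinTy.out = id := funext LinTy.mk_out
  rw [Multiset.map_coe, List.map_map, hid, List.map_id, Multiset.coe_toList]

/-- The arrow of linear types is the one of representatives. -/
theorem LinTy.arrow_mk (l r : List PreLin) :
    LinTy.arrow (↑(l.map LinTy.mk)) (↑(r.map LinTy.mk)) = LinTy.mk (PreLin.arrow l r) := by
  refine Quotient.sound (s := PreLin.setoid) (PreLin.Equiv.arrow ?_ ?_) <;>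
  · apply rel_of_map_mk_eq
    rw [map_mk_map_out, Multiset.map_coe]

theorem LinTy.arrow_injective {M N M' N' : MultiTy}
    (h : LinTy.arrow M N = LinTy.arrow M' N') : M = M' ∧ N = N' := by
  have h1 := Quotient.exact h
  cases h1 with
  | arrow hl hr =>
    have hl' := Multiset.map_mk_eq_map_mk_of_rel (r := PreLin.setoid.r) hl
    have hr' := Multiset.map_mk_eq_map_mk_of_rel (r := PreLin.setoid.r) hr
    constructor
    · rw [← map_mk_map_out M, ← map_mk_map_out M']; exact hl'
    · rw [← map_mk_map_out N, ← map_mk_map_out N']; exact hr'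

/-- Linear types are generated by the arrow, inductively. -/
theorem LinTy.induction {P : LinTy → Prop}
    (h : ∀ M N : MultiTy, (∀ L ∈ M, P L) → (∀ L ∈ N, P L) → P (LinTy.arrow M N)) (L : LinTy) :
    P L := by
  have key : ∀ a : PreLin, P (LinTy.mk a) := by
    intro a
    induction a using PreLin.induction with
    | h l r hl hr =>
      rw [← LinTy.arrow_mk]
      apply h
      · intro L hL
        obtain ⟨b, hb, rfl⟩ := List.mem_map.1 (Multiset.mem_coe.1 hL)
        exact hl b hb
      · intro L hL
        obtain ⟨b, hb, rfl⟩ := List.mem_map.1 (Multiset.mem_coe.1 hL)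
        exact hr b hb
  exact Quotient.ind (s := PreLin.setoid) key L

/-! ## The multi type system -/

/-- Typing contexts assign a multi type to every variable; a variable which is absent from the
context has the empty multi type. (The contexts of the derivable judgments assign a non-empty multi
type to finitely many variables only.) The pointwise sum is the disjoint union of contexts. -/
abbrev TyCtx : Type := ℕ → MultiTy

/-- The context `x : M`. -/
def TyCtx.single (x : ℕ) (M : MultiTy) : TyCtx := Pi.single x M

/-- The context `Γ, x : M` of the body of a binder, where the bound variable `x` has index `0`. -/
def TyCtx.cons (M : MultiTy) (Γ : TyCtx) : TyCtx := fun n => Nat.casesOn n M Γ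

mutual

/-- `HasLin Γ t L`: there is a derivation of `Γ ⊢ t : L`, with `L` a linear type. -/
inductive HasLin : TyCtx → VTm → LinTy → Prop
  | ax (x : ℕ) (L : LinTy) : HasLin (TyCtx.single x {L}) (VTm.var x) L
  | lam {Γ : TyCtx} {t : VTm} {M N : MultiTy} (h : HasMulti (TyCtx.cons M Γ) t N) :
      HasLin Γ (VTm.lam t) (LinTy.arrow M N)

/-- `HasMulti Γ t M`: there is a derivation of `Γ ⊢ t : M`, with `M` a multi type. -/
inductive HasMulti : TyCtx → VTm → MultiTy → Prop
  | many {v : VTm} (hv : v.IsValue) (n : ℕ) (Γ : Fin n → TyCtx) (L : Fin n → LinTy)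
      (h : ∀ i, HasLin (Γ i) v (L i)) : HasMulti (∑ i, Γ i) v (∑ i, {L i})
  | app {Γ Δ : TyCtx} {t u : VTm} {M N : MultiTy} (ht : HasMulti Γ t {LinTy.arrow M N})
      (hu : HasMulti Δ u M) : HasMulti (Γ + Δ) (VTm.app t u) N
  | es {Γ Δ : TyCtx} {t u : VTm} {M N : MultiTy} (ht : HasMulti (TyCtx.cons M Γ) t N)
      (hu : HasMulti Δ u M) : HasMulti (Γ + Δ) (VTm.es t u) N

end

/-- The type preorder: every multi type judgment of `t` is one of `t'`. -/
def TypeLE (t t' : VTm) : Prop :=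
  ∀ (Γ : TyCtx) (M : MultiTy), HasMulti Γ t M → HasMulti Γ t' M

end CbV

namespace CbV

/-! ### A sized and syntax-directed presentation of the type system -/

-- Measure a derivation by its number of (λ) and (@) rules. Substituting values adds sizes exactly
-- (`Der.subst`), so firing a redex loses one (λ) and one (@). Left reduction therefore preserves
-- judgments and shrinks their size (`LeftRed.der`), and typable terms have left normal forms
-- (`Der.not_leftDiv`). Expansion also preserves judgments (`LeftRed.der_expand`), so it suffices to
-- compare normal forms.
--
-- The theorem is then a strong induction on the size of the derivation for `t`
-- (`IsEnfSimulation.der`). Clause 1 contradicts typability, clause 2 is immediate, and in clause 3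
-- the bodies have smaller derivations. In clause 4, a derivation of `L⟨x v⟩` splits into one for
-- `L`, with some hole type `A`, and one for `x v`. A fresh `z : A` in the hole gives a derivation
-- for `L⟨z⟩` that lacks the (@) of `x v`, so induction moves it to `L'⟨z⟩`. Without weakening, the
-- type of `z` is exactly the type of the hole of `L'` (`CtxDer.of_plug_var`), so `x v'` can be
-- plugged back.

/-- Finite sums of judgments satisfying `P`, as in the rule (many), with a size. -/
inductive ManyOf (P : ℕ → TyCtx → LinTy → Prop) : ℕ → TyCtx → MultiTy → Prop
  | nil : ManyOf P 0 0 0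
  | cons {n m : ℕ} {Γ Δ : TyCtx} {L : LinTy} {M : MultiTy} (h : P n Γ L) (hM : ManyOf P m Δ M) :
      ManyOf P (n + m) (Γ + Δ) (L ::ₘ M)

namespace ManyOf

variable {P : ℕ → TyCtx → LinTy → Prop}

theorem zero_iff {n : ℕ} {Γ : TyCtx} : ManyOf P n Γ 0 ↔ n = 0 ∧ Γ = 0 := by
  constructor
  · intro h
    generalize hM : (0 : MultiTy) = M at h
    cases h with
    | nil => exact ⟨rfl, rfl⟩
    | cons => exact absurd hM (Multiset.zero_ne_cons)
  · rintro ⟨rfl, rfl⟩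
    exact nil

theorem singleton_iff {n : ℕ} {Γ : TyCtx} {L : LinTy} : ManyOf P n Γ {L} ↔ P n Γ L := by
  constructor
  · intro h
    generalize hM : ({L} : MultiTy) = M at h
    cases h with
    | nil => exact absurd hM (Multiset.singleton_ne_zero L)
    | cons h h' =>
      obtain ⟨rfl, rfl⟩ := (Multiset.singleton_eq_cons_iff _ ).1 hM
      obtain ⟨rfl, rfl⟩ := zero_iff.1 h'
      simpa using h
  · intro h
    simpa using cons h nil

theorem add {n m : ℕ} {Γ Δ : TyCtx} {M N : MultiTy} (h : ManyOf P n Γ M) (h' : ManyOf P m Δ N) :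
    ManyOf P (n + m) (Γ + Δ) (M + N) := by
  induction h with
  | nil => simpa using h'
  | cons hL _ ih =>
    rw [add_assoc, add_assoc, Multiset.cons_add]
    exact cons hL ih

theorem split {n : ℕ} {Γ : TyCtx} {M₁ M₂ : MultiTy} (h : ManyOf P n Γ (M₁ + M₂)) :
    ∃ n₁ n₂ Γ₁ Γ₂, n = n₁ + n₂ ∧ Γ = Γ₁ + Γ₂ ∧ ManyOf P n₁ Γ₁ M₁ ∧ ManyOf P n₂ Γ₂ M₂ := by
  generalize hM : M₁ + M₂ = M at h
  induction h generalizing M₁ M₂ with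
  | nil =>
    obtain ⟨rfl, rfl⟩ := add_eq_zero.1 hM
    exact ⟨0, 0, 0, 0, rfl, by simp, nil, nil⟩
  | @cons n m Γ Δ L M hL _ ih =>
    have hmem : L ∈ M₁ + M₂ := hM ▸ Multiset.mem_cons_self L M
    rcases Multiset.mem_add.1 hmem with h1 | h2
    · obtain ⟨M₁, rfl⟩ := Multiset.exists_cons_of_mem h1
      rw [Multiset.cons_add, Multiset.cons_inj_right] at hM
      obtain ⟨n₁, n₂, Γ₁, Γ₂, rfl, rfl, h₁, h₂⟩ := ih hM
      exact ⟨_, _, _, _, (add_assoc _ _ _).symm, (add_assoc _ _ _).symm, cons hL h₁, h₂⟩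
    · obtain ⟨M₂, rfl⟩ := Multiset.exists_cons_of_mem h2
      rw [Multiset.add_cons, Multiset.cons_inj_right] at hM
      obtain ⟨n₁, n₂, Γ₁, Γ₂, rfl, rfl, h₁, h₂⟩ := ih hM
      exact ⟨_, _, _, _, add_left_comm _ _ _, add_left_comm _ _ _, h₁, cons hL h₂⟩

/-- Each summand has size at most `n`; the hypothesis is needed only up to that bound, which is what
an induction on size can supply. -/
theorem transfer {Q : ℕ → TyCtx → LinTy → Prop} {n : ℕ} {Γ : TyCtx} {M : MultiTy}
    (h : ManyOf P n Γ M) (hPQ : ∀ k ≤ n, ∀ Δ L, P k Δ L → ∃ l, Q l Δ L) :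
    ∃ m, ManyOf Q m Γ M := by
  induction h with
  | nil => exact ⟨0, nil⟩
  | cons hL _ ih =>
    obtain ⟨l, hl⟩ := hPQ _ (Nat.le_add_right _ _) _ _ hL
    obtain ⟨m, hm⟩ := ih fun k hk => hPQ k (hk.trans (Nat.le_add_left _ _))
    exact ⟨_, cons hl hm⟩

end ManyOf

/-- Sized judgments of an abstraction, from those of its body. -/
def LamLin (D : ℕ → TyCtx → MultiTy → Prop) (n : ℕ) (Γ : TyCtx) (L : LinTy) : Prop :=
  ∃ k M N, n = k + 1 ∧ L = LinTy.arrow M N ∧ D k (TyCtx.cons M Γ) N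

/-- `Der t n Γ M`: there is a derivation of `Γ ⊢ t : M` with `n` rules (lam) and (@). -/
def Der : Tm → ℕ → TyCtx → MultiTy → Prop
  | .var x => fun n Γ M => n = 0 ∧ Γ = TyCtx.single x M
  | .lam b => ManyOf (LamLin (Der b))
  | .app t u => fun n Γ N => ∃ n₁ n₂ Γ₁ Γ₂ M, n = n₁ + n₂ + 1 ∧ Γ = Γ₁ + Γ₂ ∧
      Der t n₁ Γ₁ {LinTy.arrow M N} ∧ Der u n₂ Γ₂ M

/-! ### Contexts -/

namespace TyCtx

theorem single_add (x : ℕ) (M N : MultiTy) : single x (M + N) = single x M + single x N :=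
  Pi.single_add (f := fun _ => MultiTy) x M N

theorem single_zero (x : ℕ) : single x 0 = 0 := Pi.single_zero x

theorem single_apply_self (x : ℕ) (M : MultiTy) : single x M x = M :=
  Pi.single_eq_same (M := fun _ => MultiTy) x M

theorem single_apply_of_ne {x y : ℕ} (h : y ≠ x) (M : MultiTy) : single x M y = 0 :=
  Pi.single_eq_of_ne (M := fun _ => MultiTy) h M

@[simp] theorem cons_zero (M : MultiTy) (Γ : TyCtx) : cons M Γ 0 = M := rfl

@[simp] theorem cons_succ (M : MultiTy) (Γ : TyCtx) (n : ℕ) : cons M Γ (n + 1) = Γ n := rfl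

theorem cons_eta (Γ : TyCtx) : cons (Γ 0) (fun n => Γ (n + 1)) = Γ := by
  funext n
  cases n <;> rfl

theorem cons_add (M N : MultiTy) (Γ Δ : TyCtx) : cons (M + N) (Γ + Δ) = cons M Γ + cons N Δ := by
  funext n
  cases n <;> rfl

theorem cons_zero_zero : cons 0 0 = 0 := by
  funext n
  cases n <;> rfl

theorem cons_zero_sum (N : ℕ) (g : ℕ → TyCtx) :
    cons 0 (∑ x ∈ Finset.range N, g x) = ∑ x ∈ Finset.range N, cons 0 (g x) := by
  induction N with
  | zero => exact cons_zero_zero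
  | succ N ih =>
    rw [Finset.sum_range_succ, Finset.sum_range_succ, ← ih, ← cons_add, add_zero]

theorem cons_zero_add_single (M : MultiTy) (Γ : TyCtx) : cons 0 Γ + single 0 M = cons M Γ := by
  funext n
  cases n with
  | zero => simp [single_apply_self]
  | succ n => simp [single_apply_of_ne]

theorem cons_injective {M N : MultiTy} {Γ Δ : TyCtx} (h : cons M Γ = cons N Δ) :
    M = N ∧ Γ = Δ :=
  ⟨congrFun h 0, funext fun n => congrFun h (n + 1)⟩

/-- Contexts are arbitrary functions, so finite support has to be supplied; for derivable judgments
it comes from `Der.exists_bound`. -/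
theorem sum_single_of_bound {N : ℕ} {Γ : TyCtx} (h : ∀ x, N ≤ x → Γ x = 0) :
    ∑ x ∈ Finset.range N, single x (Γ x) = Γ := by
  funext y
  rw [Finset.sum_apply]
  rcases lt_or_ge y N with hy | hy
  · rw [Finset.sum_eq_single_of_mem y (Finset.mem_range.2 hy)
      fun x _ hx => single_apply_of_ne hx.symm _, single_apply_self]
  · rw [h y hy]
    refine Finset.sum_eq_zero fun x hx => single_apply_of_ne ?_ _
    have := Finset.mem_range.1 hx
    omega

end TyCtx

/-! ### Basic properties of derivations -/

theorem Der.zero {v : Tm} (hv : v.IsValue) : Der v 0 0 0 := by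
  cases hv with
  | var x => exact ⟨rfl, (TyCtx.single_zero x).symm⟩
  | lam b => exact ManyOf.nil

theorem Der.zero_inv {v : Tm} (hv : v.IsValue) {n : ℕ} {Γ : TyCtx} (h : Der v n Γ 0) :
    n = 0 ∧ Γ = 0 := by
  cases hv with
  | var x => exact ⟨h.1, h.2.trans (TyCtx.single_zero x)⟩
  | lam b => exact ManyOf.zero_iff.1 h

/-- Specific to values, whose multi types come from (many). With `Der.split`, this lets one value
serve several occurrences of a variable. -/
theorem Der.merge {v : Tm} (hv : v.IsValue) {n m : ℕ} {Γ Δ : TyCtx} {M N : MultiTy}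
    (h : Der v n Γ M) (h' : Der v m Δ N) : Der v (n + m) (Γ + Δ) (M + N) := by
  cases hv with
  | var x =>
    obtain ⟨rfl, rfl⟩ := h
    obtain ⟨rfl, rfl⟩ := h'
    exact ⟨rfl, (TyCtx.single_add _ _ _).symm⟩
  | lam b => exact ManyOf.add h h'

theorem Der.split {v : Tm} (hv : v.IsValue) {n : ℕ} {Γ : TyCtx} {M₁ M₂ : MultiTy}
    (h : Der v n Γ (M₁ + M₂)) :
    ∃ n₁ n₂ Γ₁ Γ₂, n = n₁ + n₂ ∧ Γ = Γ₁ + Γ₂ ∧ Der v n₁ Γ₁ M₁ ∧ Der v n₂ Γ₂ M₂ := by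
  cases hv with
  | var x =>
    obtain ⟨rfl, rfl⟩ := h
    exact ⟨0, 0, _, _, rfl, TyCtx.single_add _ _ _, ⟨rfl, rfl⟩, ⟨rfl, rfl⟩⟩
  | lam b => exact ManyOf.split h

theorem Der.lam_singleton {b : Tm} {n : ℕ} {Γ : TyCtx} {M N : MultiTy} :
    Der (.lam b) n Γ {LinTy.arrow M N} ↔ ∃ k, n = k + 1 ∧ Der b k (TyCtx.cons M Γ) N := by
  refine ManyOf.singleton_iff.trans ⟨?_, ?_⟩
  · rintro ⟨k, M', N', rfl, hL, h⟩
    obtain ⟨rfl, rfl⟩ := LinTy.arrow_injective hL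
    exact ⟨k, rfl, h⟩
  · rintro ⟨k, rfl, h⟩
    exact ⟨k, M, N, rfl, rfl, h⟩

/-- There is no weakening: every entry of a context comes from an axiom on an occurrence of the
variable. -/
theorem Der.relevant {t : Tm} {n : ℕ} {Γ : TyCtx} {M : MultiTy} (h : Der t n Γ M) {z : ℕ}
    (hz : ¬ t.HasFree z) : Γ z = 0 := by
  induction t generalizing n Γ M z with
  | var x =>
    obtain ⟨rfl, rfl⟩ := h
    exact TyCtx.single_apply_of_ne (Ne.symm hz) M
  | lam b ih =>
    replace h : ManyOf (LamLin (Der b)) n Γ M := h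
    induction h with
    | nil => rfl
    | cons hL _ ihM =>
      obtain ⟨k, A, B, -, -, hb⟩ := hL
      have := ih hb (z := z + 1) hz
      rw [TyCtx.cons_succ] at this
      rw [Pi.add_apply, this, ihM, add_zero]
  | app t u iht ihu =>
    obtain ⟨n₁, n₂, Γ₁, Γ₂, A, rfl, rfl, ht, hu⟩ := h
    rw [Pi.add_apply, iht ht fun hf => hz (Or.inl hf), ihu hu fun hf => hz (Or.inr hf), add_zero]

theorem Tm.exists_bound (t : Tm) : ∃ N, ∀ x, N ≤ x → ¬ t.HasFree x := by
  induction t with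
  | var y =>
    refine ⟨y + 1, fun x hx h => ?_⟩
    have : y = x := h
    omega
  | lam b ih =>
    obtain ⟨N, hN⟩ := ih
    exact ⟨N, fun x hx => hN (x + 1) (by omega)⟩
  | app t u iht ihu =>
    obtain ⟨N, hN⟩ := iht
    obtain ⟨N', hN'⟩ := ihu
    exact ⟨max N N', fun x hx h => h.elim (hN x (le_of_max_le_left hx))
      (hN' x (le_of_max_le_right hx))⟩

theorem Der.exists_bound {t : Tm} {n : ℕ} {Γ : TyCtx} {M : MultiTy} (h : Der t n Γ M) :
    ∃ N, ∀ x, N ≤ x → Γ x = 0 :=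
  t.exists_bound.imp fun _ hN x hx => h.relevant (hN x hx)

/-! ### Equivalence with the given type system -/

theorem HasMulti.cons {v : VTm} (hv : v.IsValue) {Γ Δ : TyCtx} {L : LinTy} {M : MultiTy}
    (h : HasLin Γ v L) (hM : HasMulti Δ v M) : HasMulti (Γ + Δ) v (L ::ₘ M) := by
  cases hM with
  | many _ n Δ K hK =>
    have := HasMulti.many hv (n + 1) (Fin.cons Γ Δ) (Fin.cons L K)
      (Fin.cases h hK)
    simpa [Fin.sum_univ_succ] using this
  | app => cases hv
  | es => cases hv

theorem HasMulti.nil {v : VTm} (hv : v.IsValue) : HasMulti 0 v 0 := by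
  simpa using HasMulti.many hv 0 Fin.elim0 Fin.elim0 (fun i => i.elim0)

theorem Der.of_hasLin {v : Tm} (hv : v.IsValue) (n : ℕ) (Γ : Fin n → TyCtx) (L : Fin n → LinTy)
    (h : ∀ i, ∃ k, Der v k (Γ i) {L i}) : ∃ k, Der v k (∑ i, Γ i) (∑ i, {L i}) := by
  induction n with
  | zero => exact ⟨0, by simpa using Der.zero hv⟩
  | succ n ih =>
    obtain ⟨k, hk⟩ := ih (fun i => Γ i.succ) (fun i => L i.succ) fun i => h i.succ
    obtain ⟨k', hk'⟩ := h 0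
    refine ⟨k' + k, ?_⟩
    rw [Fin.sum_univ_succ, Fin.sum_univ_succ]
    exact hk'.merge hv hk

theorem hasMulti_iff_der {t : Tm} {Γ : TyCtx} {M : MultiTy} :
    HasMulti Γ t.toVTm M ↔ ∃ n, Der t n Γ M := by
  induction t generalizing Γ M with
  | var x =>
    constructor
    · intro h
      cases h with
      | many hv n Γ L h =>
        refine Der.of_hasLin (.var x) n Γ L fun i => ⟨0, rfl, ?_⟩
        have hi := h i
        -- Case analysis on the judgment needs its indices to be variables.
        generalize L i = K at hi ⊢
        generalize Γ i = Δ at hi ⊢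
        cases hi
        rfl
    · rintro ⟨n, rfl, rfl⟩
      induction M using Multiset.induction with
      | empty => rw [TyCtx.single_zero]; exact .nil (.var x)
      | cons L M ih =>
        rw [← Multiset.singleton_add, TyCtx.single_add, Multiset.singleton_add]
        exact .cons (.var x) (.ax x L) ih
  | lam b ih =>
    constructor
    · intro h
      cases h with
      | many hv n Γ L h =>
        refine Der.of_hasLin (.lam b) n Γ L fun i => ?_
        have hi := h i
        generalize L i = K at hi ⊢
        generalize Γ i = Δ at hi ⊢
        cases hi with
        | lam hb =>
          obtain ⟨k, hk⟩ := ih.1 hb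
          exact ⟨k + 1, Der.lam_singleton.2 ⟨k, rfl, hk⟩⟩
    · rintro ⟨n, h⟩
      replace h : ManyOf (LamLin (Der b)) n Γ M := h
      induction h with
      | nil => exact .nil (.lam _)
      | cons hL _ ihM =>
        obtain ⟨k, A, B, -, rfl, hb⟩ := hL
        exact .cons (.lam _) (.lam (ih.2 ⟨k, hb⟩)) ihM
  | app t u iht ihu =>
    constructor
    · intro h
      cases h with
      | many hv => cases hv
      | app ht hu =>
        obtain ⟨n, hn⟩ := iht.1 ht
        obtain ⟨m, hm⟩ := ihu.1 hu
        exact ⟨_, n, m, _, _, _, rfl, rfl, hn, hm⟩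
    · rintro ⟨_, n, m, Γ₁, Γ₂, A, rfl, rfl, ht, hu⟩
      exact .app (iht.2 ⟨n, ht⟩) (ihu.2 ⟨m, hu⟩)

/-! ### Renaming -/

/-- The action of a renaming under a binder. -/
def liftRen (f : ℕ → ℕ) : ℕ → ℕ := fun n => Nat.casesOn n 0 (fun k => f k + 1)

theorem liftRen_injective {f : ℕ → ℕ} (hf : f.Injective) : (liftRen f).Injective := by
  rintro (_ | a) (_ | b) h
  · rfl
  · exact absurd h (Nat.succ_ne_zero _).symm
  · exact absurd h (Nat.succ_ne_zero _)
  · rw [hf (Nat.succ_injective h)]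

/-- The context obtained by an injective renaming of the variables. -/
noncomputable def TyCtx.push (f : ℕ → ℕ) (Γ : TyCtx) : TyCtx := Function.extend f Γ 0

theorem TyCtx.push_add (f : ℕ → ℕ) (Γ Δ : TyCtx) : push f (Γ + Δ) = push f Γ + push f Δ := by
  have := Function.extend_add f Γ Δ (0 : TyCtx) (0 : TyCtx)
  rwa [add_zero] at this

theorem TyCtx.push_zero (f : ℕ → ℕ) : push f 0 = 0 := by
  funext y
  simp [push, Function.extend]

theorem TyCtx.push_apply {f : ℕ → ℕ} (hf : f.Injective) (Γ : TyCtx) (x : ℕ) :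
    push f Γ (f x) = Γ x := hf.extend_apply Γ 0 x

theorem TyCtx.push_apply_of_not {f : ℕ → ℕ} (Γ : TyCtx) {y : ℕ} (hy : ¬ ∃ x, f x = y) :
    push f Γ y = 0 := Function.extend_apply' Γ (0 : TyCtx) y hy

theorem TyCtx.push_single {f : ℕ → ℕ} (hf : f.Injective) (x : ℕ) (M : MultiTy) :
    push f (single x M) = single (f x) M := by
  funext y
  by_cases hy : ∃ z, f z = y
  · obtain ⟨z, rfl⟩ := hy
    rw [push_apply hf]
    by_cases hz : z = x
    · rw [hz, single_apply_self, single_apply_self]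
    · rw [single_apply_of_ne hz, single_apply_of_ne (hf.ne hz)]
  · rw [push_apply_of_not _ hy, single_apply_of_ne]
    rintro rfl
    exact hy ⟨x, rfl⟩

theorem TyCtx.push_liftRen {f : ℕ → ℕ} (hf : f.Injective) (M : MultiTy) (Γ : TyCtx) :
    push (liftRen f) (cons M Γ) = cons M (push f Γ) := by
  funext y
  cases y with
  | zero => exact push_apply (liftRen_injective hf) (cons M Γ) 0
  | succ y =>
    rw [cons_succ]
    by_cases hy : ∃ z, f z = y
    · obtain ⟨z, rfl⟩ := hy
      rw [push_apply hf]
      exact push_apply (liftRen_injective hf) (cons M Γ) (z + 1)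
    · rw [push_apply_of_not _ hy, push_apply_of_not]
      rintro ⟨_ | z, hz⟩
      · exact absurd hz (Nat.succ_ne_zero _).symm
      · exact hy ⟨z, Nat.succ_injective hz⟩

theorem TyCtx.push_succ (Γ : TyCtx) : push Nat.succ Γ = cons 0 Γ := by
  funext y
  cases y with
  | zero => exact push_apply_of_not Γ fun ⟨x, hx⟩ => Nat.succ_ne_zero x hx
  | succ y => exact push_apply Nat.succ_injective Γ y

theorem Der.rename {f : ℕ → ℕ} (hf : f.Injective) {t : Tm} {n : ℕ} {Γ : TyCtx} {M : MultiTy}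
    (h : Der t n Γ M) : Der (t.rename f) n (TyCtx.push f Γ) M := by
  induction t generalizing f n Γ M with
  | var x =>
    obtain ⟨rfl, rfl⟩ := h
    exact ⟨rfl, TyCtx.push_single hf x M⟩
  | lam b ih =>
    replace h : ManyOf (LamLin (Der b)) n Γ M := h
    change ManyOf (LamLin (Der (b.rename (liftRen f)))) n (TyCtx.push f Γ) M
    induction h with
    | nil => rw [TyCtx.push_zero]; exact .nil
    | cons hL _ ihM =>
      obtain ⟨k, A, B, rfl, rfl, hb⟩ := hL
      rw [TyCtx.push_add]
      refine .cons ⟨k, A, B, rfl, rfl, ?_⟩ ihM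
      rw [← TyCtx.push_liftRen hf]
      exact ih (liftRen_injective hf) hb
  | app t u iht ihu =>
    obtain ⟨n₁, n₂, Γ₁, Γ₂, A, rfl, rfl, ht, hu⟩ := h
    exact ⟨n₁, n₂, _, _, A, rfl, TyCtx.push_add f Γ₁ Γ₂, iht hf ht, ihu hf hu⟩

/-- By relevance the context can charge only variables in the range of `f`, hence it is a
pushforward. -/
theorem Der.of_rename {f : ℕ → ℕ} (hf : f.Injective) {t : Tm} {n : ℕ} {Γ : TyCtx} {M : MultiTy}
    (h : Der (t.rename f) n Γ M) : ∃ Δ, Γ = TyCtx.push f Δ ∧ Der t n Δ M := by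
  induction t generalizing f n Γ M with
  | var x =>
    obtain ⟨rfl, rfl⟩ := h
    exact ⟨_, (TyCtx.push_single hf x M).symm, rfl, rfl⟩
  | lam b ih =>
    replace h : ManyOf (LamLin (Der (b.rename (liftRen f)))) n Γ M := h
    change ∃ Δ, Γ = TyCtx.push f Δ ∧ ManyOf (LamLin (Der b)) n Δ M
    induction h with
    | nil => exact ⟨0, (TyCtx.push_zero f).symm, .nil⟩
    | @cons _ _ Γ _ _ _ hL _ ihM =>
      obtain ⟨k, A, B, rfl, rfl, hb⟩ := hL
      obtain ⟨Δ, rfl, hM⟩ := ihM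
      obtain ⟨Δ', hΔ', hb'⟩ := ih (liftRen_injective hf) hb
      rw [← TyCtx.cons_eta Δ', TyCtx.push_liftRen hf] at hΔ'
      obtain ⟨rfl, rfl⟩ := TyCtx.cons_injective hΔ'
      refine ⟨_, (TyCtx.push_add _ _ _).symm, .cons ⟨k, _, B, rfl, rfl, ?_⟩ hM⟩
      rwa [TyCtx.cons_eta]
  | app t u iht ihu =>
    obtain ⟨n₁, n₂, Γ₁, Γ₂, A, rfl, rfl, ht, hu⟩ := h
    obtain ⟨Δ₁, rfl, ht'⟩ := iht hf ht
    obtain ⟨Δ₂, rfl, hu'⟩ := ihu hf hu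
    exact ⟨_, (TyCtx.push_add _ _ _).symm, n₁, n₂, _, _, A, rfl, rfl, ht', hu'⟩

theorem Tm.IsValue.rename {v : Tm} (hv : v.IsValue) (f : ℕ → ℕ) : (v.rename f).IsValue := by
  cases hv with
  | var x => exact .var _
  | lam b => exact .lam _

/-! ### Substitution -/

/-- The action of a substitution under a binder. -/
def liftSub (s : ℕ → Tm) : ℕ → Tm :=
  fun n => Nat.casesOn n (Tm.var 0) (fun k => Tm.rename Nat.succ (s k))

theorem liftSub_isValue {s : ℕ → Tm} (hs : ∀ x, (s x).IsValue) (x : ℕ) :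
    (liftSub s x).IsValue := by
  cases x with
  | zero => exact .var 0
  | succ x => exact (hs x).rename _

/-- `SubDer s n Γ Δ`: the terms `s x` have the types `Δ x`, with contexts of sum `Γ` and derivations
of total size `n`. -/
def SubDer (s : ℕ → Tm) (n : ℕ) (Γ Δ : TyCtx) : Prop :=
  ∃ (N : ℕ) (m : ℕ → ℕ) (g : ℕ → TyCtx), (∀ x, Der (s x) (m x) (g x) (Δ x)) ∧
    (∀ x, N ≤ x → m x = 0 ∧ g x = 0 ∧ Δ x = 0) ∧
    n = ∑ x ∈ Finset.range N, m x ∧ Γ = ∑ x ∈ Finset.range N, g x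

theorem sum_range_of_le {A : Type*} [AddCommMonoid A] {N N' : ℕ} (hN : N ≤ N') {g : ℕ → A}
    (h : ∀ x, N ≤ x → g x = 0) : ∑ x ∈ Finset.range N, g x = ∑ x ∈ Finset.range N', g x :=
  Finset.sum_subset (Finset.range_mono hN) fun x _ hx => h x (by simpa using hx)

namespace SubDer

variable {s : ℕ → Tm}

theorem zero (hs : ∀ x, (s x).IsValue) : SubDer s 0 0 0 :=
  ⟨0, 0, 0, fun x => Der.zero (hs x), fun _ _ => ⟨rfl, rfl, rfl⟩, rfl, rfl⟩

theorem zero_inv (hs : ∀ x, (s x).IsValue) {n : ℕ} {Γ : TyCtx} (h : SubDer s n Γ 0) :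
    n = 0 ∧ Γ = 0 := by
  obtain ⟨N, m, g, h, -, rfl, rfl⟩ := h
  exact ⟨Finset.sum_eq_zero fun x _ => ((h x).zero_inv (hs x)).1,
    Finset.sum_eq_zero fun x _ => ((h x).zero_inv (hs x)).2⟩

theorem add (hs : ∀ x, (s x).IsValue) {n n' : ℕ} {Γ Γ' Δ Δ' : TyCtx} (h : SubDer s n Γ Δ)
    (h' : SubDer s n' Γ' Δ') : SubDer s (n + n') (Γ + Γ') (Δ + Δ') := by
  obtain ⟨N, m, g, h, hN, rfl, rfl⟩ := h
  obtain ⟨N', m', g', h', hN', rfl, rfl⟩ := h'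
  refine ⟨max N N', m + m', g + g', fun x => (h x).merge (hs x) (h' x), fun x hx => ?_, ?_, ?_⟩
  · obtain ⟨h1, h2, h3⟩ := hN x (le_of_max_le_left hx)
    obtain ⟨h1', h2', h3'⟩ := hN' x (le_of_max_le_right hx)
    simp [*]
  · rw [sum_range_of_le (le_max_left N N') fun x hx => (hN x hx).1,
      sum_range_of_le (le_max_right N N') fun x hx => (hN' x hx).1, ← Finset.sum_add_distrib]
    rfl
  · rw [sum_range_of_le (le_max_left N N') fun x hx => (hN x hx).2.1,
      sum_range_of_le (le_max_right N N') fun x hx => (hN' x hx).2.1, ← Finset.sum_add_distrib]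
    rfl

/-- Split value by value. Beyond the bound `N` a zero sum of multisets has zero summands, and a
value has only the trivial derivation at the empty type. -/
theorem split (hs : ∀ x, (s x).IsValue) {n : ℕ} {Γ Δ₁ Δ₂ : TyCtx} (h : SubDer s n Γ (Δ₁ + Δ₂)) :
    ∃ n₁ n₂ Γ₁ Γ₂, n = n₁ + n₂ ∧ Γ = Γ₁ + Γ₂ ∧ SubDer s n₁ Γ₁ Δ₁ ∧ SubDer s n₂ Γ₂ Δ₂ := by
  obtain ⟨N, m, g, h, hN, rfl, rfl⟩ := h
  choose m₁ m₂ g₁ g₂ hm hg h₁ h₂ using fun x => (h x).split (hs x)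
  refine ⟨_, _, _, _, ?_, ?_, ⟨N, m₁, g₁, h₁, fun x hx => ?_, rfl, rfl⟩,
    ⟨N, m₂, g₂, h₂, fun x hx => ?_, rfl, rfl⟩⟩
  · rw [← Finset.sum_add_distrib]
    exact Finset.sum_congr rfl fun x _ => hm x
  · rw [← Finset.sum_add_distrib]
    exact Finset.sum_congr rfl fun x _ => hg x
  · have hz := (add_eq_zero.1 (hN x hx).2.2).1
    have h0 := h₁ x
    rw [hz] at h0
    exact ⟨(h0.zero_inv (hs x)).1, (h0.zero_inv (hs x)).2, hz⟩
  · have hz := (add_eq_zero.1 (hN x hx).2.2).2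
    have h0 := h₂ x
    rw [hz] at h0
    exact ⟨(h0.zero_inv (hs x)).1, (h0.zero_inv (hs x)).2, hz⟩

theorem single (hs : ∀ x, (s x).IsValue) {x n : ℕ} {Γ : TyCtx} {M : MultiTy} :
    SubDer s n Γ (TyCtx.single x M) ↔ Der (s x) n Γ M := by
  constructor
  · rintro ⟨N, m, g, h, hN, rfl, rfl⟩
    have h0 : ∀ y, y ≠ x → m y = 0 ∧ g y = 0 := fun y hy => by
      have := h y
      rw [TyCtx.single_apply_of_ne hy] at this
      exact this.zero_inv (hs y)
    have hx := h x
    rw [TyCtx.single_apply_self] at hx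
    rwa [Finset.sum_eq_single x (fun y _ hy => (h0 y hy).1)
        fun h => (hN x (by simpa using h)).1,
      Finset.sum_eq_single x (fun y _ hy => (h0 y hy).2)
        fun h => (hN x (by simpa using h)).2.1]
  · intro h
    refine ⟨x + 1, Pi.single x n, Pi.single x Γ, fun y => ?_, fun y hy => ?_, ?_, ?_⟩
    · by_cases hy : y = x
      · subst hy
        rwa [TyCtx.single_apply_self, Pi.single_eq_same, Pi.single_eq_same]
      · rw [TyCtx.single_apply_of_ne hy, Pi.single_eq_of_ne hy, Pi.single_eq_of_ne hy]
        exact Der.zero (hs y)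
    · have hy : y ≠ x := by omega
      rw [TyCtx.single_apply_of_ne hy, Pi.single_eq_of_ne hy, Pi.single_eq_of_ne hy]
      exact ⟨rfl, rfl, rfl⟩
    · simp
    · rw [Finset.sum_eq_single_of_mem x (by simp) fun y _ hy => Pi.single_eq_of_ne hy _,
        Pi.single_eq_same]

/-- The bound variable is sent to itself by an axiom of size `0`, so the total size is unchanged. -/
theorem lift {n : ℕ} {Γ Δ : TyCtx} (h : SubDer s n Γ Δ) (M : MultiTy) :
    SubDer (liftSub s) n (TyCtx.cons M Γ) (TyCtx.cons M Δ) := by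
  obtain ⟨N, m, g, h, hN, rfl, rfl⟩ := h
  refine ⟨N + 1, fun x => Nat.casesOn x 0 m,
    fun x => Nat.casesOn x (TyCtx.single 0 M) (fun k => TyCtx.cons 0 (g k)), ?_, ?_, ?_, ?_⟩
  · rintro (_ | x)
    · exact ⟨rfl, rfl⟩
    · have := (h x).rename Nat.succ_injective
      rwa [TyCtx.push_succ] at this
  · rintro (_ | x) hx
    · omega
    · obtain ⟨h1, h2, h3⟩ := hN x (by omega)
      refine ⟨h1, ?_, h3⟩
      change TyCtx.cons 0 (g x) = 0
      rw [h2, TyCtx.cons_zero_zero]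
  · rw [Finset.sum_range_succ']
    rfl
  · rw [Finset.sum_range_succ', ← TyCtx.cons_zero_add_single, TyCtx.cons_zero_sum]
    rfl

theorem of_lift {n : ℕ} {Γ Δ : TyCtx} {M : MultiTy}
    (h : SubDer (liftSub s) n (TyCtx.cons M Γ) Δ) :
    ∃ Δ', Δ = TyCtx.cons M Δ' ∧ SubDer s n Γ Δ' := by
  obtain ⟨N, m, g, h, hN, rfl, hΓ⟩ := h
  obtain ⟨h0, hg0⟩ : m 0 = 0 ∧ g 0 = TyCtx.single 0 (Δ 0) := h 0
  choose g' hg' h' using fun x => (h (x + 1) : Der ((s x).rename Nat.succ) _ _ _).of_rename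
    Nat.succ_injective
  simp only [TyCtx.push_succ] at hg'
  rw [sum_range_of_le N.le_succ fun x hx => (hN x hx).2.1, Finset.sum_range_succ', hg0,
    Finset.sum_congr rfl fun x _ => hg' x, ← TyCtx.cons_zero_sum,
    TyCtx.cons_zero_add_single] at hΓ
  obtain ⟨rfl, rfl⟩ := TyCtx.cons_injective hΓ
  refine ⟨fun x => Δ (x + 1), (TyCtx.cons_eta Δ).symm, N, fun x => m (x + 1), g', h',
    fun x hx => ?_, ?_, rfl⟩
  · obtain ⟨h1, h2, h3⟩ := hN (x + 1) (by omega)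
    rw [hg', ← TyCtx.cons_zero_zero] at h2
    exact ⟨h1, (TyCtx.cons_injective h2).2, h3⟩
  · rw [sum_range_of_le N.le_succ fun x hx => (hN x hx).1, Finset.sum_range_succ', h0, add_zero]

end SubDer

/-- Axioms cost nothing, so replacing them by derivations of the substituted values adds sizes
exactly. Values are needed to distribute these derivations among subterms. -/
theorem Der.subst {s : ℕ → Tm} (hs : ∀ x, (s x).IsValue) {t : Tm} {n k : ℕ} {Γ Δ : TyCtx}
    {M : MultiTy} (h : Der t n Δ M) (hd : SubDer s k Γ Δ) : Der (t.subst s) (n + k) Γ M := by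
  induction t generalizing s n k Γ Δ M with
  | var x =>
    obtain ⟨rfl, rfl⟩ := h
    rw [zero_add]
    exact (SubDer.single hs).1 hd
  | lam b ih =>
    replace h : ManyOf (LamLin (Der b)) n Δ M := h
    change ManyOf (LamLin (Der (b.subst (liftSub s)))) (n + k) Γ M
    induction h generalizing k Γ with
    | nil =>
      obtain ⟨rfl, rfl⟩ := hd.zero_inv hs
      exact .nil
    | cons hL _ ihM =>
      obtain ⟨l, A, B, rfl, rfl, hb⟩ := hL
      obtain ⟨k₁, k₂, Γ₁, Γ₂, rfl, rfl, h₁, h₂⟩ := hd.split hs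
      rw [add_add_add_comm]
      exact .cons ⟨l + k₁, A, B, by omega, rfl, ih (liftSub_isValue hs) hb (h₁.lift A)⟩ (ihM h₂)
  | app t u iht ihu =>
    obtain ⟨n₁, n₂, Δ₁, Δ₂, A, rfl, rfl, ht, hu⟩ := h
    obtain ⟨k₁, k₂, Γ₁, Γ₂, rfl, rfl, h₁, h₂⟩ := hd.split hs
    exact ⟨n₁ + k₁, n₂ + k₂, Γ₁, Γ₂, A, by omega, rfl, iht hs ht h₁, ihu hs hu h₂⟩

/-- Each occurrence of `x` demands its own type for `s x`; these demands are summed into `Δ`, which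
is possible because `s x` is a value. -/
theorem Der.of_subst {s : ℕ → Tm} (hs : ∀ x, (s x).IsValue) {t : Tm} {l : ℕ} {Γ : TyCtx}
    {M : MultiTy} (h : Der (t.subst s) l Γ M) :
    ∃ n k Δ, Der t n Δ M ∧ SubDer s k Γ Δ := by
  induction t generalizing s l Γ M with
  | var x => exact ⟨0, l, _, ⟨rfl, rfl⟩, (SubDer.single hs).2 h⟩
  | lam b ih =>
    replace h : ManyOf (LamLin (Der (b.subst (liftSub s)))) l Γ M := h
    change ∃ n k Δ, ManyOf (LamLin (Der b)) n Δ M ∧ SubDer s k Γ Δ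
    induction h with
    | nil => exact ⟨0, 0, 0, .nil, .zero hs⟩
    | cons hL _ ihM =>
      obtain ⟨l, A, B, rfl, rfl, hb⟩ := hL
      obtain ⟨n, k, Δ, hM, hd⟩ := ihM
      obtain ⟨n', k', Δ', hb', hd'⟩ := ih (liftSub_isValue hs) hb
      obtain ⟨Δ'', rfl, hd''⟩ := hd'.of_lift
      exact ⟨_, _, _, .cons ⟨n', A, B, rfl, rfl, hb'⟩ hM, hd''.add hs hd⟩
  | app t u iht ihu =>
    obtain ⟨n₁, n₂, Γ₁, Γ₂, A, rfl, rfl, ht, hu⟩ := h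
    obtain ⟨n, k, Δ, ht, hd⟩ := iht hs ht
    obtain ⟨n', k', Δ', hu, hd'⟩ := ihu hs hu
    exact ⟨_, _, _, ⟨n, n', Δ, Δ', A, rfl, rfl, ht, hu⟩, hd.add hs hd'⟩

/-- The substitution of `v` for the variable `0`. -/
def instSub (v : Tm) : ℕ → Tm := fun n => Nat.casesOn n v Tm.var

theorem instSub_isValue {v : Tm} (hv : v.IsValue) (x : ℕ) : (instSub v x).IsValue := by
  cases x with
  | zero => exact hv
  | succ x => exact .var x

theorem SubDer.inst {v : Tm} {n : ℕ} {Γ Δ : TyCtx} {M : MultiTy} (hΓ : ∃ N, ∀ x, N ≤ x → Γ x = 0)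
    (h : Der v n Δ M) : SubDer (instSub v) n (Γ + Δ) (TyCtx.cons M Γ) := by
  obtain ⟨N, hN⟩ := hΓ
  refine ⟨N + 1, fun x => Nat.casesOn x n 0,
    fun x => Nat.casesOn x Δ (fun k => TyCtx.single k (Γ k)), ?_, ?_, ?_, ?_⟩
  · rintro (_ | x)
    · exact h
    · exact ⟨rfl, rfl⟩
  · rintro (_ | x) hx
    · omega
    · have hz := hN x (by omega)
      refine ⟨rfl, ?_, hz⟩
      change TyCtx.single x (Γ x) = 0
      rw [hz, TyCtx.single_zero]
  · rw [Finset.sum_range_succ']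
    simp
  · rw [Finset.sum_range_succ']
    simp only
    rw [TyCtx.sum_single_of_bound hN]
    rfl

theorem SubDer.of_inst {v : Tm} {n : ℕ} {Γ Δ : TyCtx} (h : SubDer (instSub v) n Γ Δ) :
    ∃ n' M Γ₁ Γ₂, Δ = TyCtx.cons M Γ₁ ∧ Γ = Γ₁ + Γ₂ ∧ Der v n' Γ₂ M := by
  obtain ⟨N, m, g, h, hN, -, rfl⟩ := h
  refine ⟨m 0, Δ 0, fun x => Δ (x + 1), g 0, (TyCtx.cons_eta Δ).symm, ?_, h 0⟩
  have hg : ∀ x, g (x + 1) = TyCtx.single x (Δ (x + 1)) := fun x => (h (x + 1)).2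
  rw [sum_range_of_le N.le_succ fun x hx => (hN x hx).2.1, Finset.sum_range_succ',
    Finset.sum_congr rfl fun x _ => hg x,
    TyCtx.sum_single_of_bound (Γ := fun x => Δ (x + 1)) fun x hx => (hN (x + 1) (by omega)).2.2]

/-! ### Subject reduction and expansion for the root rule -/

theorem RootBeta.der {t u : Tm} (hr : RootBeta t u) {n : ℕ} {Γ : TyCtx} {M : MultiTy}
    (h : Der t n Γ M) : ∃ m < n, Der u m Γ M := by
  obtain ⟨b, v, hv⟩ := hr
  obtain ⟨n₁, n₂, Γ₁, Γ₂, A, rfl, rfl, hb, hd⟩ := h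
  obtain ⟨k, rfl, hb'⟩ := Der.lam_singleton.1 hb
  obtain ⟨N, hN⟩ := hb'.exists_bound
  have hΓ : ∃ N, ∀ x, N ≤ x → Γ₁ x = 0 := ⟨N, fun x hx => hN (x + 1) (by omega)⟩
  -- The redex had size `(k + 1) + n₂ + 1`: its (λ) and its (@) are gone.
  exact ⟨k + n₂, by omega, hb'.subst (instSub_isValue hv) (SubDer.inst hΓ hd)⟩

theorem RootBeta.der_expand {t u : Tm} (hr : RootBeta t u) {n : ℕ} {Γ : TyCtx} {M : MultiTy}
    (h : Der u n Γ M) : ∃ m, Der t m Γ M := by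
  obtain ⟨b, v, hv⟩ := hr
  obtain ⟨n₁, k, Δ, hb, hd⟩ := Der.of_subst (instSub_isValue hv) h
  obtain ⟨n₂, A, Γ₁, Γ₂, rfl, rfl, hv⟩ := hd.of_inst
  exact ⟨_, n₁ + 1, n₂, Γ₁, Γ₂, A, rfl, rfl, Der.lam_singleton.2 ⟨n₁, rfl, hb⟩, hv⟩

/-! ### Left contexts -/

/-- `CtxDer L A n Γ M`: sized typing of the left context `L` with type `M`, for a hole of
type `A`. -/
def CtxDer : LCtx → MultiTy → ℕ → TyCtx → MultiTy → Prop
  | .hole, A, n, Γ, M => n = 0 ∧ Γ = 0 ∧ M = A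
  | .valApp v _ L, A, n, Γ, M => ∃ n₁ n₂ Γ₁ Γ₂ B, n = n₁ + n₂ + 1 ∧ Γ = Γ₁ + Γ₂ ∧
      Der v n₁ Γ₁ {LinTy.arrow B M} ∧ CtxDer L A n₂ Γ₂ B
  | .app L u, A, n, Γ, M => ∃ n₁ n₂ Γ₁ Γ₂ B, n = n₁ + n₂ + 1 ∧ Γ = Γ₁ + Γ₂ ∧
      CtxDer L A n₁ Γ₁ {LinTy.arrow B M} ∧ Der u n₂ Γ₂ B

theorem CtxDer.plug {L : LCtx} {t : Tm} {A M : MultiTy} {n m : ℕ} {Γ Δ : TyCtx}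
    (hL : CtxDer L A n Γ M) (ht : Der t m Δ A) : Der (L.plug t) (n + m) (Γ + Δ) M := by
  induction L generalizing n Γ M with
  | hole =>
    obtain ⟨rfl, rfl, rfl⟩ := hL
    rwa [zero_add, zero_add]
  | valApp v hv L ih =>
    obtain ⟨n₁, n₂, Γ₁, Γ₂, B, rfl, rfl, hd, hL⟩ := hL
    exact ⟨n₁, n₂ + m, Γ₁, Γ₂ + Δ, B, by omega, add_assoc _ _ _, hd, ih hL⟩
  | app L u ih =>
    obtain ⟨n₁, n₂, Γ₁, Γ₂, B, rfl, rfl, hL, hu⟩ := hL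
    exact ⟨n₁ + m, n₂, Γ₁ + Δ, Γ₂, B, by omega, add_right_comm _ _ _, ih hL, hu⟩

/-- The hole is under no binder and is typed exactly once, so contexts and sizes split additively.
-/
theorem Der.of_plug {L : LCtx} {t : Tm} {M : MultiTy} {n : ℕ} {Γ : TyCtx}
    (h : Der (L.plug t) n Γ M) :
    ∃ A n₁ n₂ Γ₁ Γ₂, n = n₁ + n₂ ∧ Γ = Γ₁ + Γ₂ ∧ CtxDer L A n₁ Γ₁ M ∧ Der t n₂ Γ₂ A := by
  induction L generalizing n Γ M with
  | hole => exact ⟨M, 0, n, 0, Γ, (zero_add n).symm, (zero_add Γ).symm, ⟨rfl, rfl, rfl⟩, h⟩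
  | valApp v hv L ih =>
    obtain ⟨n₁, n₂, Γ₁, Γ₂, B, rfl, rfl, hd, hL⟩ := h
    obtain ⟨A, k₁, k₂, Δ₁, Δ₂, rfl, rfl, hL, ht⟩ := ih hL
    exact ⟨A, n₁ + k₁ + 1, k₂, Γ₁ + Δ₁, Δ₂, by omega, (add_assoc _ _ _).symm,
      ⟨n₁, k₁, Γ₁, Δ₁, B, rfl, rfl, hd, hL⟩, ht⟩
  | app L u ih =>
    obtain ⟨n₁, n₂, Γ₁, Γ₂, B, rfl, rfl, hL, hu⟩ := h
    obtain ⟨A, k₁, k₂, Δ₁, Δ₂, rfl, rfl, hL, ht⟩ := ih hL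
    exact ⟨A, k₁ + n₂ + 1, k₂, Δ₁ + Γ₂, Δ₂, by omega, add_right_comm _ _ _,
      ⟨k₁, n₂, Δ₁, Γ₂, B, rfl, rfl, hL, hu⟩, ht⟩

theorem CtxDer.relevant {L : LCtx} {A M : MultiTy} {n : ℕ} {Γ : TyCtx} (h : CtxDer L A n Γ M)
    {z : ℕ} (hz : ¬ L.HasFree z) : Γ z = 0 := by
  induction L generalizing n Γ M with
  | hole =>
    obtain ⟨-, rfl, -⟩ := h
    rfl
  | valApp v hv L ih =>
    obtain ⟨n₁, n₂, Γ₁, Γ₂, B, -, rfl, hd, hL⟩ := h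
    rw [Pi.add_apply, hd.relevant fun hf => hz (Or.inl hf), ih hL fun hf => hz (Or.inr hf),
      add_zero]
  | app L u ih =>
    obtain ⟨n₁, n₂, Γ₁, Γ₂, B, -, rfl, hL, hu⟩ := h
    rw [Pi.add_apply, ih hL fun hf => hz (Or.inl hf), hu.relevant fun hf => hz (Or.inr hf),
      add_zero]

/-- The types of a fresh variable in the hole determine a typing of the context. -/
theorem CtxDer.of_plug_var {L : LCtx} {A M : MultiTy} {n z : ℕ} {Γ : TyCtx}
    (hz : ¬ L.HasFree z) (hΓ : Γ z = 0) (h : Der (L.plug (.var z)) n (Γ + TyCtx.single z A) M) :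
    CtxDer L A n Γ M := by
  obtain ⟨A', n₁, n₂, Γ₁, _, rfl, he, hL, rfl, rfl⟩ := h.of_plug
  -- Compare the entries at `z`: freshness leaves only the contribution of the hole on either side.
  have hA : A = A' := by
    have := congrFun he z
    rwa [Pi.add_apply, Pi.add_apply, hL.relevant hz, hΓ, zero_add, zero_add,
      TyCtx.single_apply_self, TyCtx.single_apply_self] at this
  subst hA
  have hΓ₁ : Γ = Γ₁ := by
    funext x
    have := congrFun he x
    rwa [Pi.add_apply, Pi.add_apply, add_left_inj] at this
  rwa [hΓ₁]

/-! ### Subject reduction and expansion, normalization -/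

theorem LeftRed.der {t u : Tm} (hr : LeftRed t u) {n : ℕ} {Γ : TyCtx} {M : MultiTy}
    (h : Der t n Γ M) : ∃ m < n, Der u m Γ M := by
  obtain ⟨L, hr⟩ := hr
  obtain ⟨A, n₁, n₂, Γ₁, Γ₂, rfl, rfl, hL, ht⟩ := h.of_plug
  obtain ⟨m, hm, hu⟩ := hr.der ht
  exact ⟨n₁ + m, by omega, hL.plug hu⟩

theorem LeftRed.der_expand {t u : Tm} (hr : LeftRed t u) {n : ℕ} {Γ : TyCtx} {M : MultiTy}
    (h : Der u n Γ M) : ∃ m, Der t m Γ M := by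
  obtain ⟨L, hr⟩ := hr
  obtain ⟨A, n₁, n₂, Γ₁, Γ₂, rfl, rfl, hL, hu⟩ := h.of_plug
  obtain ⟨m, ht⟩ := hr.der_expand hu
  exact ⟨n₁ + m, hL.plug ht⟩

theorem LeftEval.der {t u : Tm} (he : LeftEval t u) {n : ℕ} {Γ : TyCtx} {M : MultiTy}
    (h : Der t n Γ M) : ∃ m ≤ n, Der u m Γ M := by
  obtain ⟨hr, -⟩ := he
  induction hr with
  | refl => exact ⟨n, le_rfl, h⟩
  | tail _ hs ih =>
    obtain ⟨m, hm, h⟩ := ih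
    obtain ⟨k, hk, h⟩ := hs.der h
    exact ⟨k, by omega, h⟩

theorem LeftEval.der_expand {t u : Tm} (he : LeftEval t u) {n : ℕ} {Γ : TyCtx} {M : MultiTy}
    (h : Der u n Γ M) : ∃ m, Der t m Γ M := by
  obtain ⟨hr, -⟩ := he
  induction hr using Relation.ReflTransGen.head_induction_on with
  | refl => exact ⟨n, h⟩
  | head hs _ ih =>
    obtain ⟨m, h⟩ := ih
    exact hs.der_expand h

/-- Each left step strictly decreases the size, so any reduction from `t` stops. -/
theorem Der.not_leftDiv {t : Tm} {n : ℕ} {Γ : TyCtx} {M : MultiTy} (h : Der t n Γ M) :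
    ¬ LeftDiv t := by
  rw [LeftDiv, not_not]
  induction n using Nat.strong_induction_on generalizing t with
  | _ n ih =>
    by_cases hn : LeftNormal t
    · exact ⟨t, .refl, hn⟩
    · rw [LeftNormal] at hn
      push Not at hn
      obtain ⟨u, hu⟩ := hn
      obtain ⟨m, hm, h⟩ := hu.der h
      obtain ⟨v, hv, hn⟩ := ih m hm h
      exact ⟨v, .head hu hv, hn⟩

/-! ### Eager normal form simulations are included in the type preorder -/

/-- Only the size of the derivation for `t` drives the induction, so no bound on `m` is needed. -/
theorem IsEnfSimulation.der {R : Tm → Tm → Prop} (hR : IsEnfSimulation R) {t t' : Tm}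
    (htt' : R t t') {n : ℕ} {Γ : TyCtx} {M : MultiTy} (h : Der t n Γ M) :
    ∃ m, Der t' m Γ M := by
  induction n using Nat.strong_induction_on generalizing t t' Γ M with
  | _ n ih =>
    cases hR t t' htt' with
    | enf1 hd => exact absurd hd h.not_leftDiv
    | enf2 x he he' =>
      obtain ⟨m, -, h⟩ := he.der h
      exact he'.der_expand h
    | enf3 b b' he he' hb =>
      obtain ⟨m, hm, h⟩ := he.der h
      have key : ∃ k, ManyOf (LamLin (Der b')) k Γ M :=
        -- Each copy has size `k = l + 1 ≤ m ≤ n`, so its body is below `n`. An empty `M` needs no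
        -- copy.
        ManyOf.transfer (n := m) h fun k hk Δ L ⟨l, A, B, hl, hL, hd⟩ => by
          obtain ⟨l', hd'⟩ := ih l (by omega) hb hd
          exact ⟨l' + 1, l', A, B, rfl, hL, hd'⟩
      exact key.elim fun k hk => he'.der_expand (u := .lam b') hk
    | enf4 L L' x v v' hv hv' he he' hvv' z hz hz' hL =>
      obtain ⟨m, hm, h⟩ := he.der h
      obtain ⟨A, n₁, n₂, Γ₁, Γ₂, rfl, rfl, hc, ht⟩ := h.of_plug
      obtain ⟨k₁, k₂, Δ₁, Δ₂, B, rfl, rfl, hx, hv⟩ := ht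
      -- The (@) of `x v` makes both `k₂` and `n₁` smaller than `n`; the axiom for `z` adds nothing
      -- to `n₁`.
      obtain ⟨l, hl⟩ := ih k₂ (by omega) hvv' hv
      obtain ⟨j, hj⟩ := ih n₁ (by omega) hL
        (hc.plug (t := .var z) (m := 0) (Δ := TyCtx.single z A) ⟨rfl, rfl⟩)
      -- `L'` gets the same hole type and context as `L`, so the typing of `x` is reused unchanged.
      have hc' := CtxDer.of_plug_var hz' (hc.relevant hz) hj
      exact he'.der_expand (hc'.plug (t := .app (.var x) v')
        ⟨k₁, l, Δ₁, Δ₂, B, rfl, rfl, hx, hl⟩)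

theorem IsEnfSimulation.hasMulti {R : Tm → Tm → Prop} (hR : IsEnfSimulation R) {t t' : Tm}
    (htt' : R t t') {Γ : TyCtx} {M : MultiTy} (h : HasMulti Γ t.toVTm M) :
    HasMulti Γ t'.toVTm M := by
  obtain ⟨n, h⟩ := hasMulti_iff_der.1 h
  exact hasMulti_iff_der.2 (hR.der htt' h)

end CbV

theorem propositionl :
    (∀ R : CbV.Tm → CbV.Tm → Prop, CbV.IsEnfSimulation R →
      ∀ t t' : CbV.Tm, R t t' →
        ∀ (Γ : CbV.TyCtx) (M : CbV.MultiTy),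
          CbV.HasMulti Γ t.toVTm M → CbV.HasMulti Γ t'.toVTm M) ∧
    (∀ t t' : CbV.Tm, CbV.EnfSimilar t t' → CbV.TypeLE t.toVTm t'.toVTm) :=
  ⟨fun _ hR _ _ htt' _ _ h => hR.hasMulti htt' h,
    fun _ _ ⟨_, hR, htt'⟩ _ _ h => hR.hasMulti htt' h⟩
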